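/- **Setting.** Let $n,\ell\in\mathbb N_0$ and $0=\tau_0<\tau_1<\dots<\tau_\ell=r$. Let $|\cdot|$ be the max norm on $\mathbb R^n$ and on $\mathbb R^{(\ell+1)n}$, let $\mathcal L^\infty$ be the set of essentially bounded Lebesgue measurable functions $[-r,0]\to\mathbb R^n$, and let $L^\infty$ be the space of their classes modulo equality almost everywhere, with the essential supremum norm $\|\cdot\|$. A sequence $\phi^k\in L^\infty$ converges weakly-* to $\phi^0\in L^\infty$, written $\phi^k\rightharpoonup\phi^0$, if $\int_{-r}^0 g^T\phi^k\,ds\to\int_{-r}^0 g^T\phi^0\,ds$ for all $g\in L^1([-r,0],\mathbb R^n)$. For a history $\phi$ and a function $x$ on an interval starting at $t_0$, the concatenation $\mathsf x=\phi\diamond_{t_0}x$ is given by $\mathsf x(t)=\phi(t-t_0)$ for $t_0-r\le t<t_0$ and $\mathsf x(t)=x(t)$ for $t\ge t_0$. Put $\mathsf x_t(s)=\mathsf x(t+s)$ for $s\in[-r,0]$ and $\mathsf x(t-\tau_{0:\ell})=(\mathsf x(t-\tau_0),\dots,\mathsf x(t-\tau_\ell))$. **Assumptions.** Let $f:\mathbb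 R_{\ge0}\times\mathbb R^{(\ell+1)n}\times L^\infty\to\mathbb R^n$ satisfy the following. 1. For all $R,T>0$ there are $L\ge0$ and a null set $Z$ such that $|f(t,\xi,\phi)-f(t,\zeta,\psi)|\le L\max\{|\xi-\zeta|,\|\phi-\psi\|\}$ whenever $t\in[0,T]\setminus Z$ and $|\xi|,|\zeta|,\|\phi\|,\|\psi\|\le R$. 2. $f(\cdot,0,0)$ is locally essentially bounded. 3. For all $0\le t_0<T$, $\phi\in\mathcal L^\infty$ and continuous $x:[t_0,T]\to\mathbb R^n$, the function $t\mapsto f(t,\mathsf x(t-\tau_{0:\ell}),\mathsf x_t)$, $\mathsf x=\phi\diamond_{t_0}x$, is Lebesgue measurable on $[t_0,T]$. 4. For all $T,R>0$ there is a null set $Z$ such that for every $\varepsilon>0$ and every sequence $\phi^k\rightharpoonup\phi^0$ with $\|\phi^k\|\le R$ there is $j$ with $|f(t,\xi,\phi^k)-f(t,\xi,\phi^0)|<\varepsilon$ for all $t\in[0,T]\setminus Z$, $|\xi|\le R$ and $k\ge j$. 5. For all $t_0\ge0$, $R\ge0$, continuous $x:[t_0,t_0+r]\to\mathbb R^n$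 with $|x|\le R$, sequences $\phi^k\rightharpoonup\phi^0$ with $\|\phi^k\|\le R$, and $\varepsilon>0$, there is $j$ such that for all $t\in[t_0,t_0+r]$ and $k\ge j$, with $\mathsf x^k=\phi^k\diamond_{t_0}x$ and $\mathsf x^0=\phi^0\diamond_{t_0}x$, the integral below is well defined and $$\Big|\int_{t_0}^t\big[f(s,\mathsf x^k(s-\tau_{0:\ell}),\mathsf x^0_s)-f(s,\mathsf x^0(s-\tau_{0:\ell}),\mathsf x^0_s)\big]ds\Big|<\varepsilon .$$ **System.** Consider, for $t_0\ge0$ and $(\xi,\phi)\in\mathbb R^n\times L^\infty$, $$\dot x(t)=f(t,\mathsf x(t-\tau_{0:\ell}),\mathsf x_t)\quad(t\ge t_0),\qquad \mathsf x=\phi\diamond_{t_0}x,\qquad x(t_0)=\xi .$$ A solution on an interval $J=[t_0,b)$ or $[t_0,b]$, $t_0<b\le\infty$, is a locally absolutely continuous $x:J\to\mathbb R^n$ with $x(t)=\xi+\int_{t_0}^tf(s,\mathsf x(s-\tau_{0:\ell}),\mathsf x_s)\,ds$ for all $t\in J$ (the representative of $\phi$ is immaterial); it is maximally defined if it has no strict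 extension to a solution. The system is *forward complete* if for all $t_0\ge0$ and $(\xi,\phi)\in\mathbb R^n\times L^\infty$ there is a maximally defined solution with domain $[t_0,\infty)$. It has *bounded reachability sets* if it is forward complete and for all $0\le t_0<T$ and $R>0$ there is $M$ such that every maximally defined solution $x$ from initial time $t_0$ and any $(\xi,\phi)$ with $|\xi|\le R$, $\|\phi\|\le R$ is defined and satisfies $|x(t)|\le M$ for all $t\in[t_0,T]$. **Corollary 1.** Under these assumptions, the system is forward complete if and only if it has bounded reachability sets. -/

import Mathlib

open MeasureTheory Set Filter Topology
open scoped ENNReal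

namespace DelaySystem

/-- Lebesgue measure on the history interval `[-r, 0]`. -/
noncomputable abbrev histMeasure (r : ℝ) : Measure ℝ := volume.restrict (Icc (-r) 0)

/-- `L^∞([-r,0], ℝⁿ)`: classes modulo equality a.e., with the essential supremum norm. As everywhere
below, `ℝⁿ = Fin n → ℝ` carries the max norm. -/
abbrev LInf (n : ℕ) (r : ℝ) : Type := Lp (Fin n → ℝ) ∞ (histMeasure r)

/-- Right-hand sides `f (t, (ξ₀, …, ξ_ℓ), φ)`. Only the values at times `t ≥ 0` are ever used. -/
abbrev RHS (n ℓ : ℕ) (r : ℝ) : Type :=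
  ℝ → (Fin (ℓ + 1) → Fin n → ℝ) → LInf n r → (Fin n → ℝ)

/-- The concatenation of the history `φ` (shifted to `[t₀ - r, t₀)`) and of `x` (from `t₀` on). -/
noncomputable def conc {n : ℕ} (t₀ : ℝ) (φ x : ℝ → Fin n → ℝ) : ℝ → Fin n → ℝ :=
  fun t => if t < t₀ then φ (t - t₀) else x t

open Classical in
/-- The class in `L^∞([-r,0], ℝⁿ)` of the segment `s ↦ X (t + s)`. The segment is essentially bounded
wherever this is used, see `memLp_conc_segment`; the value `0` in the other case plays no role. -/
noncomputable def segment {n : ℕ} (r : ℝ) (X : ℝ → Fin n → ℝ) (t : ℝ) : LInf n r :=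
  if h : MemLp (fun s => X (t + s)) ∞ (histMeasure r) then h.toLp _ else 0

/-- The discrete-delay argument `(X (t - τ₀), …, X (t - τ_ℓ))`. -/
def delayed {n ℓ : ℕ} (τ : Fin (ℓ + 1) → ℝ) (X : ℝ → Fin n → ℝ) (t : ℝ) :
    Fin (ℓ + 1) → Fin n → ℝ :=
  fun i => X (t - τ i)

theorem memLp_conc_segment {n : ℕ} {r t₀ T t : ℝ} {φ x : ℝ → Fin n → ℝ}
    (hφ : MemLp φ ∞ (histMeasure r)) (hx : ContinuousOn x (Icc t₀ T)) (ht : t ∈ Icc t₀ T) :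
    MemLp (fun s => conc t₀ φ x (t + s)) ∞ (histMeasure r) := by
  have hA : MeasurableSet {s : ℝ | t + s < t₀} := measurableSet_lt (by fun_prop) (by fun_prop)
  have h1 : MemLp (fun s => φ (t + s - t₀)) ∞
      ((histMeasure r).restrict {s : ℝ | t + s < t₀}) := by
    have hmp : MeasurePreserving (fun s : ℝ => s + (t - t₀)) volume volume :=
      measurePreserving_add_right volume (t - t₀)
    have h := hφ.comp_measurePreserving
      (hmp.restrict_preimage (measurableSet_Icc (a := -r) (b := (0 : ℝ))))
    have h' : MemLp (fun s => φ (t + s - t₀)) ∞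
        (volume.restrict ((fun s : ℝ => s + (t - t₀)) ⁻¹' Icc (-r) 0)) := by
      convert h using 1
      funext s
      simp only [Function.comp_apply]
      congr 1
      ring
    refine h'.mono_measure ?_
    rw [histMeasure, Measure.restrict_restrict hA]
    refine Measure.restrict_mono ?_ le_rfl
    rintro s ⟨hs, hs'⟩
    simp only [mem_ofPred_eq, mem_Icc, mem_preimage] at *
    constructor <;> linarith [ht.1]
  have h2 : MemLp (fun s => x (t + s)) ∞
      ((histMeasure r).restrict {s : ℝ | t + s < t₀}ᶜ) := by
    have hc : ContinuousOn (fun s => x (t + s)) (Icc (t₀ - t) 0) := by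
      refine hx.comp (by fun_prop) ?_
      intro s hs
      exact ⟨by linarith [hs.1], by linarith [hs.2, ht.2]⟩
    have h : MemLp (fun s => x (t + s)) ∞ (volume.restrict (Icc (t₀ - t) 0)) := by
      obtain ⟨C, hC⟩ := isCompact_Icc.exists_bound_of_continuousOn hc
      exact memLp_top_of_bound (hc.aestronglyMeasurable measurableSet_Icc) C
        (ae_restrict_of_forall_mem measurableSet_Icc hC)
    refine h.mono_measure ?_
    rw [histMeasure, Measure.restrict_restrict hA.compl]
    refine Measure.restrict_mono ?_ le_rfl
    rintro s ⟨hs, hs'⟩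
    simp only [mem_ofPred_eq, mem_Icc, mem_compl_iff, not_lt] at *
    constructor <;> linarith
  classical
  have h := MemLp.piecewise hA h1 h2
  exact h

/-- Weak-* convergence in `L^∞([-r,0], ℝⁿ)`, tested against all `g ∈ L^1([-r,0], ℝⁿ)`. -/
def WeakStarTendsto {n : ℕ} {r : ℝ} (φ : ℕ → LInf n r) (φ₀ : LInf n r) : Prop :=
  ∀ g : ℝ → Fin n → ℝ, Integrable g (histMeasure r) →
    Tendsto (fun k => ∫ s, g s ⬝ᵥ φ k s ∂(histMeasure r)) atTop
      (𝓝 (∫ s, g s ⬝ᵥ φ₀ s ∂(histMeasure r)))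

/-- The basic regularity assumption, uniformly over a family `F` of right-hand sides: the Lipschitz
constant and the local essential bound do not depend on `f ∈ F`, the null sets may. -/
structure UniformLipschitz {n ℓ : ℕ} {r : ℝ} (τ : Fin (ℓ + 1) → ℝ) (F : Set (RHS n ℓ r)) :
    Prop where
  lipschitz : ∀ R > 0, ∀ T > 0, ∃ L : ℝ, 0 ≤ L ∧ ∀ f ∈ F, ∃ Z : Set ℝ, volume Z = 0 ∧
    ∀ t ∈ Icc 0 T \ Z, ∀ ξ ζ : Fin (ℓ + 1) → Fin n → ℝ, ∀ φ ψ : LInf n r,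
      ‖ξ‖ ≤ R → ‖ζ‖ ≤ R → ‖φ‖ ≤ R → ‖ψ‖ ≤ R →
        ‖f t ξ φ - f t ζ ψ‖ ≤ L * max ‖ξ - ζ‖ ‖φ - ψ‖
  bounded_zero : ∀ T > 0, ∃ M : ℝ, ∀ f ∈ F, ∀ᵐ t ∂(volume.restrict (Icc 0 T)), ‖f t 0 0‖ ≤ M
  measurable : ∀ f ∈ F, ∀ t₀ ≥ 0, ∀ T > t₀, ∀ φ x : ℝ → Fin n → ℝ,
    MemLp φ ∞ (histMeasure r) → ContinuousOn x (Icc t₀ T) →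
      AEMeasurable (fun t => f t (delayed τ (conc t₀ φ x) t) (segment r (conc t₀ φ x) t))
        (volume.restrict (Icc t₀ T))

/-- The weak-* continuity assumption on a family `F` of right-hand sides. The class `φ k ∈ L^∞` enters
`conc` through a representative; another one changes the integrand on a null set of times only. -/
structure WeakStarAssumption {n ℓ : ℕ} {r : ℝ} (τ : Fin (ℓ + 1) → ℝ) (F : Set (RHS n ℓ r)) :
    Prop extends UniformLipschitz τ F where
  distributed : ∀ T > 0, ∀ R > 0, ∃ Z : RHS n ℓ r → Set ℝ, (∀ f ∈ F, volume (Z f) = 0) ∧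
    ∀ ε > 0, ∀ (φ : ℕ → LInf n r) (φ₀ : LInf n r), (∀ k, ‖φ k‖ ≤ R) → WeakStarTendsto φ φ₀ →
      ∃ j : ℕ, ∀ f ∈ F, ∀ t ∈ Icc 0 T \ Z f, ∀ ξ : Fin (ℓ + 1) → Fin n → ℝ, ‖ξ‖ ≤ R →
        ∀ k ≥ j, ‖f t ξ (φ k) - f t ξ φ₀‖ < ε
  discrete : ∀ t₀ ≥ 0, ∀ R ≥ 0, ∀ x : ℝ → Fin n → ℝ,
    ContinuousOn x (Icc t₀ (t₀ + r)) → (∀ t ∈ Icc t₀ (t₀ + r), ‖x t‖ ≤ R) →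
    ∀ (φ : ℕ → LInf n r) (φ₀ : LInf n r), (∀ k, ‖φ k‖ ≤ R) → WeakStarTendsto φ φ₀ →
    ∀ ε > 0, ∃ j : ℕ, ∀ t ∈ Icc t₀ (t₀ + r), ∀ k ≥ j, ∀ f ∈ F,
      IntervalIntegrable (fun s =>
        f s (delayed τ (conc t₀ (φ k) x) s) (segment r (conc t₀ φ₀ x) s)
          - f s (delayed τ (conc t₀ φ₀ x) s) (segment r (conc t₀ φ₀ x) s)) volume t₀ t ∧
      ‖∫ s in t₀..t,
        (f s (delayed τ (conc t₀ (φ k) x) s) (segment r (conc t₀ φ₀ x) s)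
          - f s (delayed τ (conc t₀ φ₀ x) s) (segment r (conc t₀ φ₀ x) s))‖ < ε

/-- `J = [t₀, b)` or `J = [t₀, b]` with `t₀ < b ≤ ∞`. -/
def IsForwardInterval (t₀ : ℝ) (J : Set ℝ) : Prop :=
  J = Ici t₀ ∨ ∃ b > t₀, J = Ico t₀ b ∨ J = Icc t₀ b

/-- `x` is, on `J`, a solution of `x'(t) = f (t, X (t - τ₀), …, X (t - τ_ℓ), X_t)` with initial time
`t₀`, `x (t₀) = ξ` and history `φ`, where `X` is the concatenation of `φ` and `x`. The values of `x`
outside `J` play no role, and neither does the choice of the representative of `φ`. -/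
structure IsSolution {n ℓ : ℕ} {r : ℝ} (τ : Fin (ℓ + 1) → ℝ) (f : RHS n ℓ r) (t₀ : ℝ)
    (ξ : Fin n → ℝ) (φ : LInf n r) (J : Set ℝ) (x : ℝ → Fin n → ℝ) : Prop where
  interval : IsForwardInterval t₀ J
  absCont : ∀ t ∈ J, AbsolutelyContinuousOnInterval x t₀ t
  integrable : ∀ t ∈ J, IntervalIntegrable
    (fun s => f s (delayed τ (conc t₀ φ x) s) (segment r (conc t₀ φ x) s)) volume t₀ t
  eq_integral : ∀ t ∈ J, x t = ξ + ∫ s in t₀..t,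
    f s (delayed τ (conc t₀ φ x) s) (segment r (conc t₀ φ x) s)

/-- A solution without strict extension. -/
def IsMaximalSolution {n ℓ : ℕ} {r : ℝ} (τ : Fin (ℓ + 1) → ℝ) (f : RHS n ℓ r) (t₀ : ℝ)
    (ξ : Fin n → ℝ) (φ : LInf n r) (J : Set ℝ) (x : ℝ → Fin n → ℝ) : Prop :=
  IsSolution τ f t₀ ξ φ J x ∧
    ∀ (J' : Set ℝ) (y : ℝ → Fin n → ℝ), IsSolution τ f t₀ ξ φ J' y → J ⊆ J' → EqOn x y J → J' = J

/-- Forward completeness: from every initial time and initial condition `(ξ, φ) ∈ ℝⁿ × L^∞` there is a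
maximally defined solution whose domain is `[t₀, ∞)`. -/
def ForwardComplete {n ℓ : ℕ} {r : ℝ} (τ : Fin (ℓ + 1) → ℝ) (f : RHS n ℓ r) : Prop :=
  ∀ t₀ ≥ 0, ∀ (ξ : Fin n → ℝ) (φ : LInf n r),
    ∃ x : ℝ → Fin n → ℝ, IsMaximalSolution τ f t₀ ξ φ (Ici t₀) x

/-- Bounded reachability sets: forward completeness, and a common bound on `[t₀, T]` for the maximally
defined solutions from all initial conditions with `|ξ| ≤ R` and `‖φ‖ ≤ R`. -/
def BoundedReachabilitySets {n ℓ : ℕ} {r : ℝ} (τ : Fin (ℓ + 1) → ℝ) (f : RHS n ℓ r) : Prop :=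
  ForwardComplete τ f ∧
    ∀ t₀ ≥ 0, ∀ T > t₀, ∀ R > 0, ∃ M : ℝ, ∀ (ξ : Fin n → ℝ) (φ : LInf n r), ‖ξ‖ ≤ R → ‖φ‖ ≤ R →
      ∀ (J : Set ℝ) (x : ℝ → Fin n → ℝ), IsMaximalSolution τ f t₀ ξ φ J x →
        ∀ t ∈ Icc t₀ T, t ∈ J ∧ ‖x t‖ ≤ M

end DelaySystem

namespace DelaySystem

/-! Bounded reachability is a compactness argument. If it failed, there would be maximal solutions
from bounded data with `‖x k (t k)‖ > k`. Along a subsequence the histories converge weakly-*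
(`exists_weakStarTendsto_subseq`) and the initial values converge in norm; by forward completeness
the limit data have a global solution `x₀`, which is bounded on compact intervals.

The contradiction is that `x k` ends up within distance 1 of `x₀`. Weak-* convergence does not make
the delayed values converge pointwise, so the change of history is measured along the fixed function
`x₀` and only after integration (`WeakStarAssumption.exists_forall_norm_integral_along_sub_lt`).
What remains compares `x k` with `x₀` under the same history, where the Lipschitz bound and a
Gronwall barrier apply (`IsSolution.norm_sub_lt`). The barrier also keeps `x k` in the ball on which
the Lipschitz constant is valid. -/

/-! ### Weak-* sequential compactness of bounded sets in `L^∞`. -/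

/-- Sequential Banach–Alaoglu for a separable space, carried over to `H` by the Riesz isomorphism.
-/
theorem exists_subseq_tendsto_inner {H : Type*} [NormedAddCommGroup H] [InnerProductSpace ℝ H]
    [CompleteSpace H] [TopologicalSpace.SeparableSpace H] {C : ℝ} (u : ℕ → H)
    (hu : ∀ k, ‖u k‖ ≤ C) :
    ∃ (w : H) (σ : ℕ → ℕ), StrictMono σ ∧
      ∀ h, Tendsto (fun k => inner ℝ (u (σ k)) h) atTop (𝓝 (inner ℝ w h)) := by
  obtain ⟨a, -, σ, hσ, ha⟩ := WeakDual.isSeqCompact_closedBall (𝕜 := ℝ) (E := H) 0 C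
    (x := fun k => StrongDual.toWeakDual (InnerProductSpace.toDual ℝ H (u k)))
    (fun k => by simpa using hu k)
  refine ⟨(InnerProductSpace.toDual ℝ H).symm (WeakDual.toStrongDual a), σ, hσ, fun h => ?_⟩
  have := (WeakDual.eval_continuous (𝕜 := ℝ) h).continuousAt.tendsto.comp ha
  simpa [Function.comp_def] using this

theorem abs_dotProduct_le {n : ℕ} (v w : Fin n → ℝ) : |v ⬝ᵥ w| ≤ n * ‖v‖ * ‖w‖ := by
  calc |v ⬝ᵥ w| ≤ ∑ i, |v i * w i| := Finset.abs_sum_le_sum_abs _ _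
    _ ≤ ∑ _i : Fin n, ‖v‖ * ‖w‖ := by
        refine Finset.sum_le_sum fun i _ => ?_
        rw [abs_mul]
        exact mul_le_mul (norm_le_pi_norm v i) (norm_le_pi_norm w i) (abs_nonneg _) (norm_nonneg _)
    _ = n * ‖v‖ * ‖w‖ := by simp [mul_assoc]

theorem LInf.ae_norm_le {n : ℕ} {r R : ℝ} {φ : LInf n r} (h : ‖φ‖ ≤ R) :
    ∀ᵐ s ∂(histMeasure r), ‖φ s‖ ≤ R := by
  have := ae_le_eLpNormEssSup (f := φ) (μ := histMeasure r)
  filter_upwards [this] with s hs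
  refine le_trans ?_ h
  rw [Lp.norm_def, eLpNorm_exponent_top, ← toReal_enorm]
  refine ENNReal.toReal_mono ?_ hs
  rw [← eLpNorm_exponent_top]
  exact Lp.eLpNorm_ne_top φ

theorem aestronglyMeasurable_dotProduct {n : ℕ} {μ : Measure ℝ} {g h : ℝ → Fin n → ℝ}
    (hg : AEStronglyMeasurable g μ) (hh : AEStronglyMeasurable h μ) :
    AEStronglyMeasurable (fun s => g s ⬝ᵥ h s) μ :=
  (Continuous.dotProduct (A := fun p : (Fin n → ℝ) × (Fin n → ℝ) => p.1) (B := fun p => p.2)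
    continuous_fst continuous_snd).comp_aestronglyMeasurable (hg.prodMk hh)

theorem integrable_dotProduct {n : ℕ} {μ : Measure ℝ} {g h : ℝ → Fin n → ℝ} {R : ℝ}
    (hg : Integrable g μ) (hh : AEStronglyMeasurable h μ) (hR : ∀ᵐ s ∂μ, ‖h s‖ ≤ R) :
    Integrable (fun s => g s ⬝ᵥ h s) μ := by
  refine Integrable.mono' ((hg.norm.const_mul n).mul_const R)
    (aestronglyMeasurable_dotProduct hg.1 hh) ?_
  filter_upwards [hR] with s hs
  exact (abs_dotProduct_le _ _).trans (by gcongr)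

/-- For bounded sequences, weak-* convergence may be tested on bounded functions. -/
theorem weakStarTendsto_of_bounded_test {n : ℕ} {r R : ℝ} {φ : ℕ → LInf n r} {φ₀ : LInf n r}
    (hφ : ∀ k, ‖φ k‖ ≤ R) (hφ₀ : ‖φ₀‖ ≤ R)
    (h : ∀ g : ℝ → Fin n → ℝ, MemLp g ∞ (histMeasure r) →
      Tendsto (fun k => ∫ s, g s ⬝ᵥ φ k s ∂(histMeasure r)) atTop
        (𝓝 (∫ s, g s ⬝ᵥ φ₀ s ∂(histMeasure r)))) :
    WeakStarTendsto φ φ₀ := by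
  intro g hg
  have hR : 0 ≤ R := (norm_nonneg _).trans hφ₀
  have hpair : ∀ (ψ : LInf n r), ‖ψ‖ ≤ R → ∀ g' : ℝ → Fin n → ℝ, Integrable g' (histMeasure r) →
      |∫ s, g s ⬝ᵥ ψ s ∂(histMeasure r) - ∫ s, g' s ⬝ᵥ ψ s ∂(histMeasure r)| ≤
        n * R * ∫ s, ‖g s - g' s‖ ∂(histMeasure r) := by
    intro ψ hψ g' hg'
    have hb := LInf.ae_norm_le hψ
    have hm := (Lp.memLp ψ).1
    rw [← integral_sub (integrable_dotProduct hg hm hb) (integrable_dotProduct hg' hm hb),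
      ← integral_const_mul]
    refine norm_integral_le_of_norm_le (f := fun s => g s ⬝ᵥ ψ s - g' s ⬝ᵥ ψ s)
      ((hg.sub hg').norm.const_mul _) ?_
    filter_upwards [hb] with s hs
    rw [← sub_dotProduct]
    refine (abs_dotProduct_le _ _).trans ?_
    have : (n : ℝ) * ‖g s - g' s‖ * ‖ψ s‖ ≤ n * ‖g s - g' s‖ * R := by gcongr
    calc _ ≤ _ := this
      _ = _ := by ring
  rw [Metric.tendsto_atTop]
  intro ε hε
  -- Simple functions are bounded and dense in `L^1`; by `hpair` the replacement costs at most `ε /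
  -- 3` for every history in the ball. The `+ 1` below avoids dividing by `n * R = 0`.
  obtain ⟨g', hg'g, hg'⟩ : ∃ g' : ℝ → Fin n → ℝ,
      n * R * ∫ s, ‖g s - g' s‖ ∂(histMeasure r) < ε / 3 ∧ MemLp g' ∞ (histMeasure r) := by
    have hδ : 0 < ε / 3 / (n * R + 1) := by positivity
    obtain ⟨g', h1, h2⟩ := (memLp_one_iff_integrable.2 hg).exists_simpleFunc_eLpNorm_sub_lt
      (by simp) (ENNReal.ofReal_pos.2 hδ).ne'
    refine ⟨g', ?_, SimpleFunc.memLp_top g' _⟩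
    have h3 : ∫ s, ‖g s - g' s‖ ∂(histMeasure r) < ε / 3 / (n * R + 1) := by
      have hi := hg.sub (memLp_one_iff_integrable.1 h2)
      have h4 := integral_norm_eq_lintegral_enorm hi.1
      simp only [Pi.sub_apply] at h4
      rw [h4]
      rw [eLpNorm_one_eq_lintegral_enorm] at h1
      exact (ENNReal.toReal_lt_of_lt_ofReal h1)
    have h5 : (n * R + 1) * (ε / 3 / (n * R + 1)) = ε / 3 := by field_simp
    have h6 : 0 ≤ ∫ s, ‖g s - g' s‖ ∂(histMeasure r) := integral_nonneg fun _ => norm_nonneg _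
    have h7 : 0 ≤ n * R := by positivity
    nlinarith
  have hg'i : Integrable g' (histMeasure r) := hg'.integrable le_top
  obtain ⟨N, hN⟩ := Metric.tendsto_atTop.1 (h g' hg') (ε / 3) (by positivity)
  refine ⟨N, fun k hk => ?_⟩
  have h1 := hpair (φ k) (hφ k) g' hg'i
  have h2 := hpair φ₀ hφ₀ g' hg'i
  have h3 := hN k hk
  rw [Real.dist_eq] at h3 ⊢
  rw [abs_lt] at h3 ⊢
  rw [abs_le] at h1 h2
  constructor <;> linarith

theorem norm_toLp_le_of_ae_bound {n : ℕ} {r R : ℝ} (hR : 0 ≤ R) {g : ℝ → Fin n → ℝ}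
    (hg : MemLp g ∞ (histMeasure r)) (h : ∀ᵐ s ∂(histMeasure r), ‖g s‖ ≤ R) :
    ‖hg.toLp g‖ ≤ R := by
  rw [Lp.norm_toLp, eLpNorm_exponent_top]
  exact ENNReal.toReal_le_of_le_ofReal hR (eLpNormEssSup_le_of_ae_bound h)

/-- Bounded sequences in `L^∞` have weak-* convergent subsequences. -/
theorem exists_weakStarTendsto_subseq {n : ℕ} {r R : ℝ} {φ : ℕ → LInf n r}
    (hφ : ∀ k, ‖φ k‖ ≤ R) :
    ∃ (φ₀ : LInf n r) (σ : ℕ → ℕ), StrictMono σ ∧ WeakStarTendsto (fun k => φ (σ k)) φ₀ := by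
  have hR : 0 ≤ R := (norm_nonneg _).trans (hφ 0)
  -- The history interval has finite measure, so `L^∞` embeds into `L²`. The Euclidean norm replaces
  -- the max norm to make this a Hilbert space.
  have htop : ∀ {g : ℝ → Fin n → ℝ}, MemLp g ∞ (histMeasure r) →
      MemLp (fun s => (WithLp.toLp 2 (g s) : EuclideanSpace ℝ (Fin n))) 2 (histMeasure r) := by
    intro g hg
    exact (hg.mono_exponent le_top).continuousLinearMap_comp
      (PiLp.continuousLinearEquiv 2 ℝ (fun _ : Fin n => ℝ)).symm.toContinuousLinearMap
  let Φ : ℕ → Lp (EuclideanSpace ℝ (Fin n)) 2 (histMeasure r) :=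
    fun k => (htop (Lp.memLp (φ k))).toLp _
  obtain ⟨C, hC⟩ : ∃ C, ∀ k, ‖Φ k‖ ≤ C := by
    set A := (PiLp.continuousLinearEquiv 2 ℝ (fun _ : Fin n => ℝ)).symm.toContinuousLinearMap
    refine ⟨_, fun k => Lp.norm_le_of_ae_bound (C := ‖A‖ * R) (by positivity) ?_⟩
    filter_upwards [(htop (Lp.memLp (φ k))).coeFn_toLp, LInf.ae_norm_le (hφ k)] with s hs hs'
    rw [hs]
    exact (A.le_opNorm _).trans (by gcongr)
  have : Fact ((1 : ℝ≥0∞) ≤ 2) := ⟨by norm_num⟩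
  have : Fact ((2 : ℝ≥0∞) ≠ ∞) := ⟨by norm_num⟩
  obtain ⟨w, σ, hσ, hw⟩ := exists_subseq_tendsto_inner Φ hC
  have htest : ∀ g : ℝ → Fin n → ℝ, MemLp g ∞ (histMeasure r) →
      Tendsto (fun k => ∫ s, g s ⬝ᵥ φ (σ k) s ∂(histMeasure r)) atTop
        (𝓝 (∫ s, g s ⬝ᵥ WithLp.ofLp (w s) ∂(histMeasure r))) := by
    intro g hg
    have h := hw ((htop hg).toLp _)
    simp only [L2.inner_def] at h
    have hlim : ∫ s, inner ℝ (w s) ((htop hg).toLp _ s) ∂(histMeasure r) =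
        ∫ s, g s ⬝ᵥ WithLp.ofLp (w s) ∂(histMeasure r) := by
      refine integral_congr_ae ?_
      filter_upwards [(htop hg).coeFn_toLp] with s hs
      rw [hs, EuclideanSpace.inner_eq_star_dotProduct]
      simp
    rw [← hlim]
    refine h.congr fun k => integral_congr_ae ?_
    filter_upwards [(htop hg).coeFn_toLp, (htop (Lp.memLp (φ (σ k)))).coeFn_toLp] with s hs hs'
    rw [hs, hs', EuclideanSpace.inner_eq_star_dotProduct]
    simp
  have hwm : AEStronglyMeasurable (fun s => WithLp.ofLp (w s)) (histMeasure r) :=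
    (PiLp.continuousLinearEquiv 2 ℝ (fun _ : Fin n => ℝ)).continuous.comp_aestronglyMeasurable
      (Lp.memLp w).1
  have hwi : ∀ i, Integrable (fun s => w s i) (histMeasure r) := by
    intro i
    exact ((Lp.memLp w).integrable (by norm_num)).eval_piLp i
  -- A priori `w` is only in `L²`. Testing against indicators times `±` unit vectors passes the
  -- bound `R` to the limit in each coordinate.
  have hbound : ∀ᵐ s ∂(histMeasure r), ‖WithLp.ofLp (w s)‖ ≤ R := by
    have hside : ∀ (i : Fin n) (c : ℝ), |c| = 1 → ∀ᵐ s ∂(histMeasure r), c * w s i ≤ R := by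
      intro i c hc
      refine ae_le_of_forall_setIntegral_le ((hwi i).const_mul c) (integrable_const R) ?_
      intro A hA _
      have hdot : ∀ v : ℝ → Fin n → ℝ, ∫ s, A.indicator (fun _ => Pi.single i c) s ⬝ᵥ v s
          ∂(histMeasure r) = ∫ s in A, c * v s i ∂(histMeasure r) := by
        intro v
        rw [← integral_indicator hA]
        congr 1
        funext s
        by_cases hs : s ∈ A <;> simp [hs]
      have hg : MemLp (A.indicator fun _ => (Pi.single i c : Fin n → ℝ)) ∞ (histMeasure r) :=
        (memLp_const _).indicator hA
      have h := htest _ hg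
      simp only [hdot] at h
      refine le_of_tendsto' h fun k => ?_
      have hb := LInf.ae_norm_le (hφ (σ k))
      have hle : ∀ᵐ s ∂(histMeasure r), ‖c * φ (σ k) s i‖ ≤ R := by
        filter_upwards [hb] with s hs
        rw [norm_mul, Real.norm_eq_abs, hc, one_mul]
        exact (norm_le_pi_norm _ i).trans hs
      refine integral_mono_ae ?_ (integrable_const R) (ae_restrict_of_ae ?_)
      · have hm : AEStronglyMeasurable (fun s => c * φ (σ k) s i) (histMeasure r) :=
          ((continuous_apply i).comp_aestronglyMeasurable (Lp.memLp (φ (σ k))).1).const_mul c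
        exact ((integrable_const R).mono' hm hle).restrict
      · filter_upwards [hle] with s hs
        exact (le_abs_self _).trans hs
    have h1 := ae_all_iff.2 fun i => hside i 1 (by simp)
    have h2 := ae_all_iff.2 fun i => hside i (-1) (by simp)
    filter_upwards [h1, h2] with s hs1 hs2
    refine (pi_norm_le_iff_of_nonneg hR).2 fun i => abs_le.2 ⟨?_, ?_⟩
    · linarith [hs2 i]
    · linarith [hs1 i]
  have hw₀ : MemLp (fun s => WithLp.ofLp (w s)) ∞ (histMeasure r) := memLp_top_of_bound hwm R hbound
  refine ⟨hw₀.toLp _, σ, hσ, weakStarTendsto_of_bounded_test (R := R) (fun k => hφ _)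
    (norm_toLp_le_of_ae_bound hR hw₀ hbound) fun g hg => ?_⟩
  convert htest g hg using 2
  refine integral_congr_ae ?_
  filter_upwards [hw₀.coeFn_toLp] with s hs
  rw [hs]

/-! ### Gronwall's inequality with a barrier. -/

theorem integral_exp_barrier (L δ t₀ t : ℝ) :
    ∫ s in t₀..t, L * (δ * Real.exp (L * (s - t₀))) = δ * Real.exp (L * (t - t₀)) - δ := by
  have h : ∀ s ∈ uIcc t₀ t, HasDerivAt (fun s => δ * Real.exp (L * (s - t₀)))
      (L * (δ * Real.exp (L * (s - t₀)))) s := by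
    intro s _
    have h1 : HasDerivAt (fun s : ℝ => L * (s - t₀)) L s := by
      simpa using ((hasDerivAt_id s).sub_const t₀).const_mul L
    have h2 := h1.exp.const_mul δ
    have h3 : δ * (Real.exp (L * (s - t₀)) * L) = L * (δ * Real.exp (L * (s - t₀))) := by ring
    rwa [h3] at h2
  rw [intervalIntegral.integral_eq_sub_of_hasDerivAt h]
  · simp
  · exact Continuous.intervalIntegrable (by fun_prop) _ _

/-- A barrier version of Gronwall's inequality: the integral estimate is only needed as long as `u`
stays below the barrier. -/
theorem norm_lt_exp_of_barrier {E : Type*} [NormedAddCommGroup E] {u : ℝ → E} {t₀ T L δ δ' : ℝ}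
    (hu : ContinuousOn u (Icc t₀ T)) (hδ : δ < δ')
    (h : ∀ t ∈ Icc t₀ T, (∀ s ∈ Ico t₀ t, ‖u s‖ ≤ δ' * Real.exp (L * (s - t₀))) →
      ‖u t‖ ≤ δ + ∫ s in t₀..t, L * (δ' * Real.exp (L * (s - t₀)))) :
    ∀ t ∈ Icc t₀ T, ‖u t‖ < δ' * Real.exp (L * (t - t₀)) := by
  by_contra! hcon
  obtain ⟨t, ht, hlt⟩ := hcon
  set m : ℝ → ℝ := fun s => δ' * Real.exp (L * (s - t₀))
  have hmc : Continuous m := by fun_prop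
  set S := {s ∈ Icc t₀ T | m s ≤ ‖u s‖}
  have hScl : IsClosed S := isClosed_Icc.isClosed_le hmc.continuousOn hu.norm
  have hSb : BddBelow S := ⟨t₀, fun s hs => hs.1.1⟩
  have hmem : sInf S ∈ S := hScl.csInf_mem ⟨t, ht, hlt⟩ hSb
  set a := sInf S
  -- At the first contact time `a` the estimate is available, and it gives `‖u a‖ ≤ m a - (δ' - δ) <
  -- m a`.
  have h1 := h a hmem.1 fun s hs => by
    by_contra! hc
    exact hs.2.not_ge (csInf_le hSb ⟨⟨hs.1, hs.2.le.trans hmem.1.2⟩, hc.le⟩)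
  rw [integral_exp_barrier] at h1
  have h2 : δ' * Real.exp (L * (a - t₀)) ≤ ‖u a‖ := hmem.2
  linarith

/-! ### Essential bounds for concatenations, delayed values and segments. -/

theorem ae_sub_of_ae_histMeasure {r : ℝ} {P : ℝ → Prop} (h : ∀ᵐ u ∂(histMeasure r), P u) (c : ℝ) :
    ∀ᵐ s, s - c ∈ Icc (-r) 0 → P (s - c) :=
  (measurePreserving_sub_right volume c).quasiMeasurePreserving.ae
    ((ae_restrict_iff' measurableSet_Icc).1 h)

/-- The bound on `x` is required only before `T`, because the barrier argument controls a solution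
only at earlier times; the endpoint is a null set. -/
theorem ae_norm_conc_le {n : ℕ} {r t₀ T R : ℝ} {φ x : ℝ → Fin n → ℝ}
    (hφ : ∀ᵐ u ∂(histMeasure r), ‖φ u‖ ≤ R) (hx : ∀ t ∈ Ico t₀ T, ‖x t‖ ≤ R) :
    ∀ᵐ s, s ∈ Icc (t₀ - r) T → ‖conc t₀ φ x s‖ ≤ R := by
  filter_upwards [ae_sub_of_ae_histMeasure hφ t₀, Measure.ae_ne volume T] with s hs hne hsT
  unfold conc
  split_ifs with h
  · exact hs ⟨by linarith [hsT.1], by linarith⟩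
  · exact hx s ⟨not_lt.1 h, lt_of_le_of_ne hsT.2 hne⟩

/-- Almost everywhere statements about a function pass to its delayed values. -/
theorem ae_delayed {ℓ : ℕ} {P : ℝ → Prop} (τ : Fin (ℓ + 1) → ℝ) (h : ∀ᵐ s, P s) :
    ∀ᵐ s, ∀ i, P (s - τ i) :=
  ae_all_iff.2 fun i => (measurePreserving_sub_right volume (τ i)).quasiMeasurePreserving.ae h

theorem ae_segment {r : ℝ} {P : ℝ → Prop} (h : ∀ᵐ s, P s) (t : ℝ) :
    ∀ᵐ s ∂(histMeasure r), P (t + s) :=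
  ae_restrict_of_ae ((measurePreserving_add_left volume t).quasiMeasurePreserving.ae h)

theorem ae_norm_delayed_conc_le {n ℓ : ℕ} {r t₀ T R : ℝ} {τ : Fin (ℓ + 1) → ℝ}
    (hτ : ∀ i, τ i ∈ Icc 0 r) (hR : 0 ≤ R) {φ x : ℝ → Fin n → ℝ}
    (hφ : ∀ᵐ u ∂(histMeasure r), ‖φ u‖ ≤ R) (hx : ∀ t ∈ Ico t₀ T, ‖x t‖ ≤ R) :
    ∀ᵐ s, s ∈ Icc t₀ T → ‖delayed τ (conc t₀ φ x) s‖ ≤ R := by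
  filter_upwards [ae_delayed τ (ae_norm_conc_le hφ hx)] with s hs hsT
  exact (pi_norm_le_iff_of_nonneg hR).2 fun i =>
    hs i ⟨by linarith [hsT.1, (hτ i).2], by linarith [hsT.2, (hτ i).1]⟩

theorem norm_segment_conc_le {n : ℕ} {r t₀ T R : ℝ} (hR : 0 ≤ R) {φ x : ℝ → Fin n → ℝ}
    (hφ : ∀ᵐ u ∂(histMeasure r), ‖φ u‖ ≤ R) (hx : ∀ t ∈ Ico t₀ T, ‖x t‖ ≤ R) {t : ℝ}
    (ht : t ∈ Icc t₀ T) : ‖segment r (conc t₀ φ x) t‖ ≤ R := by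
  unfold segment
  split_ifs with h
  · refine norm_toLp_le_of_ae_bound hR h ?_
    filter_upwards [ae_segment (ae_norm_conc_le hφ hx) t, ae_restrict_mem measurableSet_Icc]
      with s hs hs'
    exact hs ⟨by linarith [ht.1, hs'.1], by linarith [ht.2, hs'.2]⟩
  · simpa using hR

theorem norm_segment_sub_le {n : ℕ} {r t m : ℝ} (hm : 0 ≤ m) {X Y : ℝ → Fin n → ℝ}
    (hX : MemLp (fun s => X (t + s)) ∞ (histMeasure r))
    (hY : MemLp (fun s => Y (t + s)) ∞ (histMeasure r))
    (h : ∀ᵐ s ∂(histMeasure r), ‖X (t + s) - Y (t + s)‖ ≤ m) :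
    ‖segment r X t - segment r Y t‖ ≤ m := by
  rw [segment, segment, dif_pos hX, dif_pos hY, ← MemLp.toLp_sub]
  exact norm_toLp_le_of_ae_bound hm _ h

/-! ### Bounds and integrability of the right-hand side. -/

/-- The right-hand side along the function `X`. -/
noncomputable def along {n ℓ : ℕ} {r : ℝ} (τ : Fin (ℓ + 1) → ℝ) (f : RHS n ℓ r)
    (X : ℝ → Fin n → ℝ) (s : ℝ) : Fin n → ℝ :=
  f s (delayed τ X s) (segment r X s)

/-- Compare with `f t 0 0`. The null set is fixed before `ξ` and `φ`, so that arguments depending on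
`t` may be inserted. -/
theorem UniformLipschitz.exists_ae_norm_le {n ℓ : ℕ} {r : ℝ} {τ : Fin (ℓ + 1) → ℝ}
    {f : RHS n ℓ r} (hf : UniformLipschitz τ {f}) {R T : ℝ} (hR : 0 < R) (hT : 0 < T) :
    ∃ C : ℝ, ∀ᵐ t, t ∈ Icc 0 T → ∀ (ξ : Fin (ℓ + 1) → Fin n → ℝ) (φ : LInf n r),
      ‖ξ‖ ≤ R → ‖φ‖ ≤ R → ‖f t ξ φ‖ ≤ C := by
  obtain ⟨L, hL, hLf⟩ := hf.lipschitz R hR T hT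
  obtain ⟨Z, hZ, hLip⟩ := hLf f rfl
  obtain ⟨M, hM⟩ := hf.bounded_zero T hT
  refine ⟨L * R + M, ?_⟩
  filter_upwards [(ae_restrict_iff' measurableSet_Icc).1 (hM f rfl), compl_mem_ae_iff.2 hZ]
    with t htM htZ htT ξ φ hξ hφ
  have h1 := hLip t ⟨htT, htZ⟩ ξ 0 φ 0 hξ (by simpa using hR.le) hφ (by simpa using hR.le)
  have h2 : L * max ‖ξ - 0‖ ‖φ - 0‖ ≤ L * R := by
    simp only [sub_zero]
    exact mul_le_mul_of_nonneg_left (max_le hξ hφ) hL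
  calc ‖f t ξ φ‖ = ‖(f t ξ φ - f t 0 0) + f t 0 0‖ := by simp
    _ ≤ _ := norm_add_le _ _
    _ ≤ _ := add_le_add (h1.trans h2) (htM htT)

theorem UniformLipschitz.integrableOn_along {n ℓ : ℕ} {r : ℝ} {τ : Fin (ℓ + 1) → ℝ}
    (hτ : ∀ i, τ i ∈ Icc 0 r) {f : RHS n ℓ r} (hf : UniformLipschitz τ {f}) {t₀ T : ℝ}
    (ht₀ : 0 ≤ t₀) (hT : t₀ < T) (φ : LInf n r) {x : ℝ → Fin n → ℝ}
    (hx : ContinuousOn x (Icc t₀ T)) :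
    IntegrableOn (along τ f (conc t₀ φ x)) (Icc t₀ T) := by
  obtain ⟨C₀, hC₀⟩ := isCompact_Icc.exists_bound_of_continuousOn hx
  set R := max (max C₀ ‖φ‖) 1
  have hR : 0 < R := lt_of_lt_of_le one_pos (le_max_right _ _)
  have hφR := LInf.ae_norm_le (φ := φ) (R := R) ((le_max_right _ _).trans (le_max_left _ _))
  have hxR : ∀ t ∈ Ico t₀ T, ‖x t‖ ≤ R := fun t ht =>
    (hC₀ t (Ico_subset_Icc_self ht)).trans ((le_max_left _ _).trans (le_max_left _ _))
  obtain ⟨C, hC⟩ := hf.exists_ae_norm_le hR (ht₀.trans_lt hT)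
  refine Integrable.mono' (integrable_const C)
    (hf.measurable f rfl t₀ ht₀ T hT φ x (Lp.memLp φ) hx).aestronglyMeasurable ?_
  rw [ae_restrict_iff' measurableSet_Icc]
  filter_upwards [hC, ae_norm_delayed_conc_le hτ hR.le hφR hxR] with s hs hs' hsT
  exact hs ⟨ht₀.trans hsT.1, hsT.2⟩ _ _ (hs' hsT) (norm_segment_conc_le hR.le hφR hxR hsT)

theorem IsSolution.continuousOn {n ℓ : ℕ} {r : ℝ} {τ : Fin (ℓ + 1) → ℝ} {f : RHS n ℓ r} {t₀ T : ℝ}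
    {ξ : Fin n → ℝ} {φ : LInf n r} {J : Set ℝ} {x : ℝ → Fin n → ℝ}
    (hx : IsSolution τ f t₀ ξ φ J x) (hT : T ∈ J) (htT : t₀ ≤ T) : ContinuousOn x (Icc t₀ T) := by
  simpa [uIcc_of_le htT] using (hx.absCont T hT).continuousOn

/-! ### Comparison and uniqueness of solutions. -/

/-- Two solutions on `[t₀, T]` stay close as long as the right-hand sides along the reference solution
with the two different histories have close integrals. -/
theorem IsSolution.norm_sub_lt {n ℓ : ℕ} {r : ℝ} {τ : Fin (ℓ + 1) → ℝ} (hτ : ∀ i, τ i ∈ Icc 0 r)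
    {f : RHS n ℓ r} (hf : UniformLipschitz τ {f}) {t₀ T R L δ δ' : ℝ} {Z : Set ℝ} (ht₀ : 0 ≤ t₀)
    (hT : t₀ < T) (hL : 0 ≤ L) (hZ : volume Z = 0)
    (hLip : ∀ t ∈ Icc 0 T \ Z, ∀ ξ ζ : Fin (ℓ + 1) → Fin n → ℝ, ∀ φ ψ : LInf n r,
      ‖ξ‖ ≤ R → ‖ζ‖ ≤ R → ‖φ‖ ≤ R → ‖ψ‖ ≤ R → ‖f t ξ φ - f t ζ ψ‖ ≤ L * max ‖ξ - ζ‖ ‖φ - ψ‖)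
    {ξ ξ₀ : Fin n → ℝ} {φ φ₀ : LInf n r} {J J₀ : Set ℝ} {x x₀ : ℝ → Fin n → ℝ}
    (hx : IsSolution τ f t₀ ξ φ J x) (hx₀ : IsSolution τ f t₀ ξ₀ φ₀ J₀ x₀)
    (hJ : Icc t₀ T ⊆ J) (hJ₀ : Icc t₀ T ⊆ J₀) (hφ : ‖φ‖ ≤ R)
    (hx₀R : ∀ t ∈ Icc t₀ T, ‖x₀ t‖ + 1 ≤ R) (hδ0 : 0 ≤ δ) (hδ : δ < δ')
    (hδ' : δ' * Real.exp (L * (T - t₀)) ≤ 1)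
    (hint : ∀ t ∈ Icc t₀ T, ‖ξ - ξ₀‖ +
      ‖∫ s in t₀..t, (along τ f (conc t₀ φ x₀) s - along τ f (conc t₀ φ₀ x₀) s)‖ ≤ δ) :
    ∀ t ∈ Icc t₀ T, ‖x t - x₀ t‖ < δ' * Real.exp (L * (t - t₀)) := by
  have hxc := hx.continuousOn (hJ ⟨hT.le, le_rfl⟩) hT.le
  have hx₀c := hx₀.continuousOn (hJ₀ ⟨hT.le, le_rfl⟩) hT.le
  have hR : 0 ≤ R := (norm_nonneg _).trans hφ
  have hφR := LInf.ae_norm_le hφ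
  have hmono : ∀ s t, s ≤ t → δ' * Real.exp (L * (s - t₀)) ≤ δ' * Real.exp (L * (t - t₀)) := by
    intro s t hst
    have : 0 < δ' := hδ0.trans_lt hδ
    gcongr
  refine norm_lt_exp_of_barrier (u := fun t => x t - x₀ t) (hxc.sub hx₀c) hδ ?_
  intro t ht hbar
  have hZint : IntervalIntegrable (along τ f (conc t₀ φ x₀)) volume t₀ t :=
    ((hf.integrableOn_along hτ ht₀ hT φ hx₀c).mono_set
      (by rw [uIcc_of_le ht.1]; exact Icc_subset_Icc_right ht.2)).intervalIntegrable
  have hXint : IntervalIntegrable (along τ f (conc t₀ φ x)) volume t₀ t := hx.integrable t (hJ ht)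
  have hX₀int : IntervalIntegrable (along τ f (conc t₀ φ₀ x₀)) volume t₀ t :=
    hx₀.integrable t (hJ₀ ht)
  -- The intermediate function `conc t₀ φ x₀` separates the change of history, controlled by `hint`,
  -- from the change of solution. In the latter the two concatenations agree before `t₀`.
  have heq : x t - x₀ t = (ξ - ξ₀) +
      (∫ s in t₀..t, (along τ f (conc t₀ φ x₀) s - along τ f (conc t₀ φ₀ x₀) s)) +
      ∫ s in t₀..t, (along τ f (conc t₀ φ x) s - along τ f (conc t₀ φ x₀) s) := by
    rw [intervalIntegral.integral_sub hZint hX₀int, intervalIntegral.integral_sub hXint hZint,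
      hx.eq_integral t (hJ ht), hx₀.eq_integral t (hJ₀ ht)]
    simp only [along]
    abel
  -- By `hδ'` the barrier is at most 1, which is the margin in `hx₀R`; hence `hLip` applies to `x`
  -- as well.
  have hxR : ∀ u ∈ Ico t₀ t, ‖x u‖ ≤ R := by
    intro u hu
    have h1 := hbar u hu
    have h2 := hmono u T (hu.2.le.trans ht.2)
    have h3 := hx₀R u ⟨hu.1, hu.2.le.trans ht.2⟩
    have h4 := norm_le_norm_add_norm_sub (x₀ u) (x u)
    rw [norm_sub_rev (x₀ u)] at h4
    linarith
  have hx₀R' : ∀ u ∈ Ico t₀ t, ‖x₀ u‖ ≤ R := fun u hu => by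
    linarith [hx₀R u ⟨hu.1, hu.2.le.trans ht.2⟩]
  have hconc : ∀ s ∈ Ico t₀ t, ∀ u ≤ s,
      ‖conc t₀ φ x u - conc t₀ φ x₀ u‖ ≤ δ' * Real.exp (L * (s - t₀)) := by
    intro s hs u hu
    unfold conc
    split_ifs with h
    · rw [sub_self, norm_zero]
      have : 0 < δ' := hδ0.trans_lt hδ
      positivity
    · exact (hbar u ⟨not_lt.1 h, hu.trans_lt hs.2⟩).trans (hmono u s hu)
  have hpos : ∀ s, 0 ≤ δ' * Real.exp (L * (s - t₀)) := fun s => by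
    have : 0 < δ' := hδ0.trans_lt hδ
    positivity
  have hbound : ∀ᵐ s, s ∈ Ioc t₀ t → ‖along τ f (conc t₀ φ x) s - along τ f (conc t₀ φ x₀) s‖ ≤
      L * (δ' * Real.exp (L * (s - t₀))) := by
    filter_upwards [compl_mem_ae_iff.2 hZ, Measure.ae_ne volume t,
      ae_norm_delayed_conc_le hτ hR hφR hxR, ae_norm_delayed_conc_le hτ hR hφR hx₀R']
      with s hsZ hst hs1 hs2 hs
    have hs' : s ∈ Icc t₀ t := Ioc_subset_Icc_self hs
    have hs'' : s ∈ Ico t₀ t := ⟨hs.1.le, lt_of_le_of_ne hs.2 hst⟩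
    refine (hLip s ⟨⟨ht₀.trans hs'.1, hs'.2.trans ht.2⟩, hsZ⟩ _ _ _ _ (hs1 hs') (hs2 hs')
      (norm_segment_conc_le hR hφR hxR hs') (norm_segment_conc_le hR hφR hx₀R' hs')).trans ?_
    refine mul_le_mul_of_nonneg_left (max_le ?_ ?_) hL
    · exact (pi_norm_le_iff_of_nonneg (hpos s)).2 fun i =>
        hconc s hs'' _ (by linarith [(hτ i).1])
    · refine norm_segment_sub_le (hpos s)
        (memLp_conc_segment (Lp.memLp φ) hxc ⟨hs'.1, hs'.2.trans ht.2⟩)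
        (memLp_conc_segment (Lp.memLp φ) hx₀c ⟨hs'.1, hs'.2.trans ht.2⟩) ?_
      refine ae_restrict_of_forall_mem measurableSet_Icc fun u hu => ?_
      exact hconc s hs'' _ (by linarith [hu.2])
  have h1 := intervalIntegral.norm_integral_le_of_norm_le ht.1 hbound
    (Continuous.intervalIntegrable (by fun_prop) _ _)
  rw [heq]
  exact (norm_add_le _ _).trans
    (add_le_add ((norm_add_le _ _).trans (hint t ht)) h1)

theorem IsForwardInterval.Icc_subset {t₀ T : ℝ} {J : Set ℝ} (hJ : IsForwardInterval t₀ J)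
    (hT : T ∈ J) : Icc t₀ T ⊆ J := by
  intro t ht
  rcases hJ with rfl | ⟨b, -, rfl | rfl⟩
  · exact ht.1
  · exact ⟨ht.1, ht.2.trans_lt hT.2⟩
  · exact ⟨ht.1, ht.2.trans hT.2⟩

theorem IsForwardInterval.subset_Ici {t₀ : ℝ} {J : Set ℝ} (hJ : IsForwardInterval t₀ J) :
    J ⊆ Ici t₀ := by
  rcases hJ with rfl | ⟨b, -, rfl | rfl⟩
  · exact subset_rfl
  · exact fun t ht => ht.1
  · exact fun t ht => ht.1

/-- Solutions are unique on common domains. -/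
theorem IsSolution.eqOn {n ℓ : ℕ} {r : ℝ} {τ : Fin (ℓ + 1) → ℝ} (hτ : ∀ i, τ i ∈ Icc 0 r)
    {f : RHS n ℓ r} (hf : UniformLipschitz τ {f}) {t₀ : ℝ} (ht₀ : 0 ≤ t₀)
    {ξ : Fin n → ℝ} {φ : LInf n r} {J J' : Set ℝ} {x y : ℝ → Fin n → ℝ}
    (hx : IsSolution τ f t₀ ξ φ J x) (hy : IsSolution τ f t₀ ξ φ J' y) : EqOn x y (J ∩ J') := by
  rintro T ⟨hTJ, hTJ'⟩
  rcases eq_or_lt_of_le (mem_Ici.1 (hx.interval.subset_Ici hTJ)) with rfl | hT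
  · rw [hx.eq_integral _ hTJ, hy.eq_integral _ hTJ']
    simp
  obtain ⟨C, hC⟩ := isCompact_Icc.exists_bound_of_continuousOn (hy.continuousOn hTJ' hT.le)
  set R := max (C + 1) (‖φ‖ + 1)
  have hR : 0 < R := lt_of_lt_of_le (by positivity) (le_max_right _ _)
  obtain ⟨L, hL, hLf⟩ := hf.lipschitz R hR T (ht₀.trans_lt hT)
  obtain ⟨Z, hZ, hLip⟩ := hLf f rfl
  rw [← sub_eq_zero, ← norm_le_zero_iff]
  -- With equal data, `δ = 0` is admissible, and `δ' = min ε 1 / e` makes the barrier at `T` at most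
  -- both `ε` and 1.
  refine le_of_forall_pos_le_add fun ε hε => ?_
  set e := Real.exp (L * (T - t₀))
  have he : 0 < e := Real.exp_pos _
  have hδ' : 0 < min ε 1 / e := by positivity
  have h := hx.norm_sub_lt hτ hf ht₀ hT hL hZ hLip hy (hx.interval.Icc_subset hTJ)
    (hy.interval.Icc_subset hTJ') (le_trans (by linarith) (le_max_right (C + 1) (‖φ‖ + 1)))
    (fun t ht => le_trans (by linarith [hC t ht]) (le_max_left (C + 1) (‖φ‖ + 1))) le_rfl hδ'
    (by rw [div_mul_cancel₀ _ he.ne']; exact min_le_right _ _) (fun t ht => by simp)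
    T ⟨hT.le, le_rfl⟩
  rw [div_mul_cancel₀ _ he.ne'] at h
  linarith [min_le_left ε 1]

/-- By uniqueness a global solution extends every other solution with the same data. -/
theorem IsMaximalSolution.eq_Ici {n ℓ : ℕ} {r : ℝ} {τ : Fin (ℓ + 1) → ℝ} (hτ : ∀ i, τ i ∈ Icc 0 r)
    {f : RHS n ℓ r} (hf : UniformLipschitz τ {f}) {t₀ : ℝ} (ht₀ : 0 ≤ t₀)
    {ξ : Fin n → ℝ} {φ : LInf n r} {J : Set ℝ} {x y : ℝ → Fin n → ℝ}
    (hx : IsMaximalSolution τ f t₀ ξ φ J x) (hy : IsSolution τ f t₀ ξ φ (Ici t₀) y) :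
    J = Ici t₀ := by
  have hJ := hx.1.interval.subset_Ici
  refine (hx.2 _ y hy hJ ?_).symm
  intro t ht
  exact hx.1.eqOn hτ hf ht₀ hy ⟨ht, hJ ht⟩

/-! ### Weak-* continuity in the history along a fixed function. -/

theorem coeFn_segment {n : ℕ} {r t : ℝ} {X : ℝ → Fin n → ℝ}
    (hX : MemLp (fun s => X (t + s)) ∞ (histMeasure r)) :
    segment r X t =ᵐ[histMeasure r] fun s => X (t + s) := by
  rw [segment, dif_pos hX]
  exact hX.coeFn_toLp

/-- Pairing a segment of a concatenation with `g` amounts to pairing the history with a shifted and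
truncated copy of `g`, up to a term that does not depend on the history. -/
theorem integral_dotProduct_segment_conc {n : ℕ} {r t₀ T t : ℝ} {x g : ℝ → Fin n → ℝ}
    (hx : ContinuousOn x (Icc t₀ T)) (ht : t ∈ Icc t₀ T) (hg : Integrable g (histMeasure r))
    (ψ : LInf n r) :
    ∫ s, g s ⬝ᵥ segment r (conc t₀ ψ x) t s ∂(histMeasure r) =
      ∫ u, (Iio (t₀ - t) ∩ Icc (-r) 0).indicator g (u - (t - t₀)) ⬝ᵥ ψ u ∂(histMeasure r) +
        ∫ s in (Iio (t₀ - t))ᶜ, g s ⬝ᵥ x (t + s) ∂(histMeasure r) := by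
  have hmem := memLp_conc_segment (Lp.memLp ψ) hx ht
  have hA : MeasurableSet (Iio (t₀ - t)) := measurableSet_Iio
  have hint : Integrable (fun s => g s ⬝ᵥ conc t₀ ψ x (t + s)) (histMeasure r) := by
    have hb := LInf.ae_norm_le (le_refl ‖segment r (conc t₀ ψ x) t‖)
    refine (integrable_dotProduct hg (Lp.memLp _).1 hb).congr ?_
    filter_upwards [coeFn_segment hmem] with s hs
    rw [hs]
  have h1 : ∫ s, g s ⬝ᵥ segment r (conc t₀ ψ x) t s ∂(histMeasure r) =
      ∫ s, g s ⬝ᵥ conc t₀ ψ x (t + s) ∂(histMeasure r) := by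
    refine integral_congr_ae ?_
    filter_upwards [coeFn_segment hmem] with s hs
    rw [hs]
  rw [h1, ← integral_add_compl hA hint]
  congr 1
  · have h2 : ∫ s in Iio (t₀ - t), g s ⬝ᵥ conc t₀ ψ x (t + s) ∂(histMeasure r) =
        ∫ s, (Iio (t₀ - t) ∩ Icc (-r) 0).indicator (fun s => g s ⬝ᵥ ψ (s + (t - t₀))) s := by
      rw [integral_indicator (hA.inter measurableSet_Icc),
        Measure.restrict_restrict hA]
      refine setIntegral_congr_fun (hA.inter measurableSet_Icc) fun s hs => ?_
      have hs1 : s < t₀ - t := hs.1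
      have : t + s < t₀ := by linarith
      simp only [conc, if_pos this]
      congr 2
      ring
    rw [h2, ← integral_sub_right_eq_self _ (t - t₀), ← integral_indicator measurableSet_Icc]
    congr 1
    funext u
    by_cases hu : u - (t - t₀) ∈ Iio (t₀ - t) ∩ Icc (-r) 0
    -- The shifted copy of `g` is supported in `[-r, 0)`, so restricting the integral to the history
    -- interval loses nothing.
    · have hu' : u ∈ Icc (-r) 0 := by
        have h3 : u - (t - t₀) < t₀ - t := hu.1
        have h4 := hu.2.1
        exact ⟨by linarith [ht.1], by linarith⟩
      rw [indicator_of_mem hu, indicator_of_mem hu', indicator_of_mem hu, sub_add_cancel]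
    · rw [indicator_of_notMem hu]
      simp only [indicator]
      simp [hu]
  · refine setIntegral_congr_fun hA.compl fun s hs => ?_
    have : ¬ t + s < t₀ := by
      simp only [mem_compl_iff, mem_Iio, not_lt] at hs ⊢
      linarith
    simp only [conc, if_neg this]

/-- Weak-* convergence of histories passes to the segments of concatenations. -/
theorem WeakStarTendsto.segment_conc {n : ℕ} {r t₀ T t : ℝ} {x : ℝ → Fin n → ℝ}
    {φ : ℕ → LInf n r} {φ₀ : LInf n r} (h : WeakStarTendsto φ φ₀)
    (hx : ContinuousOn x (Icc t₀ T)) (ht : t ∈ Icc t₀ T) :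
    WeakStarTendsto (fun k => segment r (conc t₀ (φ k) x) t) (segment r (conc t₀ φ₀ x) t) := by
  intro g hg
  simp only [integral_dotProduct_segment_conc hx ht hg]
  refine (h _ ?_).add_const _
  have hind : Integrable ((Iio (t₀ - t) ∩ Icc (-r) 0).indicator g) volume := by
    rw [integrable_indicator_iff (measurableSet_Iio.inter measurableSet_Icc)]
    exact IntegrableOn.mono_set hg inter_subset_right
  exact (hind.comp_sub_right (t - t₀)).restrict

/-- After time `t₀ + r` no delay reaches back to the history. This is why `discrete` is needed on
`[t₀, t₀ + r]` only. -/
theorem along_conc_eq_of_add_lt {n ℓ : ℕ} {r t₀ s : ℝ} {τ : Fin (ℓ + 1) → ℝ}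
    (hτ : ∀ i, τ i ∈ Icc 0 r) (f : RHS n ℓ r) (φ ψ x : ℝ → Fin n → ℝ) (hs : t₀ + r < s) :
    along τ f (conc t₀ φ x) s = along τ f (conc t₀ ψ x) s := by
  have hc : ∀ (φ : ℝ → Fin n → ℝ) (u : ℝ), t₀ ≤ u → conc t₀ φ x u = x u := fun φ u hu =>
    if_neg hu.not_gt
  have hd : ∀ φ : ℝ → Fin n → ℝ, delayed τ (conc t₀ φ x) s = fun i => x (s - τ i) := fun φ =>
    funext fun i => hc φ _ (by linarith [(hτ i).2])
  have hae : (fun u => conc t₀ φ x (s + u)) =ᵐ[histMeasure r] fun u => conc t₀ ψ x (s + u) := by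
    refine ae_restrict_of_forall_mem measurableSet_Icc fun u hu => ?_
    simp only
    rw [hc φ _ (by linarith [hu.1]), hc ψ _ (by linarith [hu.1])]
  have hseg : segment r (conc t₀ φ x) s = segment r (conc t₀ ψ x) s := by
    unfold segment
    by_cases h : MemLp (fun u => conc t₀ φ x (s + u)) ∞ (histMeasure r)
    · rw [dif_pos h, dif_pos ((memLp_congr_ae hae).1 h)]
      exact MemLp.toLp_congr _ _ hae
    · rw [dif_neg h, dif_neg (fun h' => h ((memLp_congr_ae hae).2 h'))]
  simp only [along, hd, hseg]

/-- If the histories converge weakly-*, the integrals of the right-hand side along their concatenations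
with a fixed `x` converge uniformly on `[t₀, T]`. -/
theorem WeakStarAssumption.exists_forall_norm_integral_along_sub_lt {n ℓ : ℕ} {r : ℝ}
    {τ : Fin (ℓ + 1) → ℝ} (hτ : ∀ i, τ i ∈ Icc 0 r) {f : RHS n ℓ r}
    (hf : WeakStarAssumption τ {f}) {t₀ T R : ℝ} (ht₀ : 0 ≤ t₀) (hT : t₀ + r < T) (hR : 0 < R)
    {x : ℝ → Fin n → ℝ} (hx : ContinuousOn x (Icc t₀ T)) (hxR : ∀ t ∈ Icc t₀ T, ‖x t‖ ≤ R)
    {φ : ℕ → LInf n r} {φ₀ : LInf n r} (hφ : ∀ k, ‖φ k‖ ≤ R) (hφ₀ : ‖φ₀‖ ≤ R)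
    (h : WeakStarTendsto φ φ₀) {ε : ℝ} (hε : 0 < ε) :
    ∃ N : ℕ, ∀ k ≥ N, ∀ t ∈ Icc t₀ T,
      ‖∫ s in t₀..t, (along τ f (conc t₀ (φ k) x) s - along τ f (conc t₀ φ₀ x) s)‖ < ε := by
  have hr : 0 ≤ r := (hτ 0).1.trans (hτ 0).2
  have hT0 : t₀ < T := by linarith
  have hTpos : 0 < T := by linarith
  have hsub : Icc t₀ (t₀ + r) ⊆ Icc t₀ T := Icc_subset_Icc_right hT.le
  have hxIco : ∀ t ∈ Ico t₀ T, ‖x t‖ ≤ R := fun t ht => hxR t (Ico_subset_Icc_self ht)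
  have hae : ∀ k, ∀ᵐ s ∂(histMeasure r), ‖φ k s‖ ≤ R := fun k => LInf.ae_norm_le (hφ k)
  have hae₀ : ∀ᵐ s ∂(histMeasure r), ‖φ₀ s‖ ≤ R := LInf.ae_norm_le hφ₀
  have hint : ∀ ψ : LInf n r, IntegrableOn (along τ f (conc t₀ ψ x)) (Icc t₀ T) := fun ψ =>
    hf.toUniformLipschitz.integrableOn_along hτ ht₀ hT0 ψ hx
  -- Delayed values from `φ k`, segment from `φ₀`: `distributed` controls the step from `φ k` to
  -- `mixed` pointwise, `discrete` the step from `mixed` to `φ₀` under the integral.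
  set mixed : ℕ → ℝ → Fin n → ℝ := fun k s =>
    f s (delayed τ (conc t₀ (φ k) x) s) (segment r (conc t₀ φ₀ x) s) with hmixed
  obtain ⟨C, hC⟩ := hf.toUniformLipschitz.exists_ae_norm_le hR hTpos
  obtain ⟨Z, hZ, hdist⟩ := hf.distributed T hTpos R hR
  obtain ⟨j, hj⟩ := hf.discrete t₀ ht₀ R hR.le x (hx.mono hsub) (fun t ht => hxR t (hsub ht)) φ φ₀
    hφ h (ε / 2) (by positivity)
  have hdel : ∀ᵐ s, ∀ k, s ∈ Icc t₀ T → ‖delayed τ (conc t₀ (φ k) x) s‖ ≤ R :=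
    ae_all_iff.2 fun k => ae_norm_delayed_conc_le hτ hR.le (hae k) hxIco
  -- The assumption `measurable` does not cover `mixed`, whose arguments stem from two histories;
  -- integrability comes from `discrete`.
  have hmixint : ∀ k ≥ j, IntervalIntegrable (mixed k) volume t₀ (t₀ + r) := by
    intro k hk
    have h1 := (hj (t₀ + r) ⟨by linarith, le_rfl⟩ k hk f rfl).1
    have h2 : IntervalIntegrable (along τ f (conc t₀ φ₀ x)) volume t₀ (t₀ + r) :=
      ((hint φ₀).mono_set (by rw [uIcc_of_le (by linarith)]; exact hsub)).intervalIntegrable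
    refine (h1.add h2).congr fun s _ => ?_
    simp [along, hmixed]
  have hdiffint : ∀ k ≥ j, IntervalIntegrable
      (fun s => along τ f (conc t₀ (φ k) x) s - mixed k s) volume t₀ (t₀ + r) := by
    intro k hk
    exact IntervalIntegrable.sub ((hint (φ k)).mono_set
      (by rw [uIcc_of_le (by linarith)]; exact hsub)).intervalIntegrable (hmixint k hk)
  have hlim : Tendsto (fun k => ∫ s in t₀..(t₀ + r), ‖along τ f (conc t₀ (φ k) x) s - mixed k s‖)
      atTop (𝓝 (∫ _s in t₀..(t₀ + r), (0 : ℝ))) := by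
    have hle : t₀ ≤ t₀ + r := by linarith
    refine intervalIntegral.tendsto_integral_filter_of_dominated_convergence (fun _ => C + C)
      ?_ ?_ (by simp) ?_
    · filter_upwards [eventually_ge_atTop j] with k hk
      rw [uIoc_of_le hle]
      exact (hdiffint k hk).1.1.norm
    · refine Eventually.of_forall fun k => ?_
      filter_upwards [hC, hdel] with s hs1 hs2 hs
      rw [uIoc_of_le hle] at hs
      have hsT : s ∈ Icc t₀ T := hsub (Ioc_subset_Icc_self hs)
      have hs0 : s ∈ Icc 0 T := ⟨ht₀.trans hsT.1, hsT.2⟩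
      rw [norm_norm]
      exact (norm_sub_le _ _).trans (add_le_add
        (hs1 hs0 _ _ (hs2 k hsT) (norm_segment_conc_le hR.le (hae k) hxIco hsT))
        (hs1 hs0 _ _ (hs2 k hsT) (norm_segment_conc_le hR.le hae₀ hxIco hsT)))
    -- The delayed values vary with `k` and need not converge; the uniformity of `distributed` in
    -- `ξ` absorbs this.
    · filter_upwards [hdel, compl_mem_ae_iff.2 (hZ f rfl)] with s hs2 hsZ hs
      rw [uIoc_of_le hle] at hs
      have hsT : s ∈ Icc t₀ T := hsub (Ioc_subset_Icc_self hs)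
      have hs0 : s ∈ Icc 0 T := ⟨ht₀.trans hsT.1, hsT.2⟩
      rw [Metric.tendsto_atTop]
      intro η hη
      obtain ⟨N, hN⟩ := hdist η hη _ _
        (fun k => norm_segment_conc_le hR.le (hae k) hxIco hsT) (h.segment_conc hx hsT)
      refine ⟨N, fun k hk => ?_⟩
      rw [dist_zero_right, norm_norm]
      exact hN f rfl s ⟨hs0, hsZ⟩ _ (hs2 k hsT) k hk
  rw [intervalIntegral.integral_zero, Metric.tendsto_atTop] at hlim
  obtain ⟨N, hN⟩ := hlim (ε / 2) (by positivity)
  refine ⟨max N j, fun k hk => ?_⟩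
  have hkj : j ≤ k := (le_max_right _ _).trans hk
  have hkN := hN k ((le_max_left _ _).trans hk)
  have hearly : ∀ t ∈ Icc t₀ (t₀ + r),
      ‖∫ s in t₀..t, (along τ f (conc t₀ (φ k) x) s - along τ f (conc t₀ φ₀ x) s)‖ < ε := by
    intro t ht
    obtain ⟨h1, h2⟩ := hj t ht k hkj f rfl
    have hsubt : uIcc t₀ t ⊆ uIcc t₀ (t₀ + r) := by
      rw [uIcc_of_le ht.1, uIcc_of_le (by linarith)]
      exact Icc_subset_Icc_right ht.2
    have h3 := (hdiffint k hkj).mono_set hsubt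
    have h4 : ∫ s in t₀..t, (along τ f (conc t₀ (φ k) x) s - along τ f (conc t₀ φ₀ x) s) =
        (∫ s in t₀..t, (along τ f (conc t₀ (φ k) x) s - mixed k s)) +
          ∫ s in t₀..t, (mixed k s - along τ f (conc t₀ φ₀ x) s) := by
      have h1' : IntervalIntegrable (fun s => mixed k s - along τ f (conc t₀ φ₀ x) s)
        volume t₀ t := h1
      rw [← intervalIntegral.integral_add h3 h1']
      simp only [sub_add_sub_cancel]
    have h5 : ‖∫ s in t₀..t, (along τ f (conc t₀ (φ k) x) s - mixed k s)‖ < ε / 2 := by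
      refine (intervalIntegral.norm_integral_le_integral_norm ht.1).trans_lt ?_
      refine lt_of_le_of_lt ?_ ((le_abs_self _).trans_lt (by simpa using hkN))
      exact intervalIntegral.integral_mono_interval le_rfl ht.1 ht.2
        (Eventually.of_forall fun _ => norm_nonneg _) (hdiffint k hkj).norm
    rw [h4]
    refine (norm_add_le _ _).trans_lt ?_
    have h6 : ‖∫ s in t₀..t, (mixed k s - along τ f (conc t₀ φ₀ x) s)‖ < ε / 2 := h2
    linarith
  intro t ht
  rcases le_total t (t₀ + r) with htr | htr
  · exact hearly t ⟨ht.1, htr⟩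
  · have hI : ∀ a ∈ Icc t₀ T, ∀ b ∈ Icc t₀ T, IntervalIntegrable
        (fun s => along τ f (conc t₀ (φ k) x) s - along τ f (conc t₀ φ₀ x) s) volume a b := by
      intro a ha b hb
      exact (((hint (φ k)).sub (hint φ₀)).mono_set
        (ordConnected_Icc.uIcc_subset ha hb)).intervalIntegrable
    have hmid : t₀ + r ∈ Icc t₀ T := ⟨by linarith, hT.le⟩
    rw [← intervalIntegral.integral_add_adjacent_intervals
      (hI t₀ ⟨le_rfl, hT0.le⟩ (t₀ + r) hmid) (hI (t₀ + r) hmid t ht)]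
    have hzero : ∫ s in (t₀ + r)..t,
        (along τ f (conc t₀ (φ k) x) s - along τ f (conc t₀ φ₀ x) s) = 0 := by
      refine intervalIntegral.integral_zero_ae (Eventually.of_forall fun s hs => ?_)
      rw [uIoc_of_le htr] at hs
      rw [along_conc_eq_of_add_lt hτ f (φ k) φ₀ x hs.1, sub_self]
    rw [hzero, add_zero]
    exact hearly _ ⟨by linarith, le_rfl⟩

/-! ### The compactness argument. -/

/-- Forward completeness gives bounded reachability sets. -/
theorem ForwardComplete.boundedReachabilitySets {n ℓ : ℕ} {r : ℝ} {τ : Fin (ℓ + 1) → ℝ}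
    (hτ : ∀ i, τ i ∈ Icc 0 r) {f : RHS n ℓ r} (hf : WeakStarAssumption τ {f})
    (hfc : ForwardComplete τ f) : BoundedReachabilitySets τ f := by
  refine ⟨hfc, fun t₀ ht₀ T hT R hR => ?_⟩
  by_contra! hcon
  choose ξ φ hξ hφ J x hx t ht hbad using fun k : ℕ => hcon k
  have hJ : ∀ k, J k = Ici t₀ := fun k => by
    obtain ⟨y, hy⟩ := hfc t₀ ht₀ (ξ k) (φ k)
    exact (hx k).eq_Ici hτ hf.toUniformLipschitz ht₀ hy.1
  have hlarge : ∀ k : ℕ, (k : ℝ) < ‖x k (t k)‖ := fun k => hbad k (by rw [hJ k]; exact (ht k).1)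
  obtain ⟨φ₀, σ₁, hσ₁, hφ₀⟩ := exists_weakStarTendsto_subseq hφ
  obtain ⟨ξ₀, -, σ₂, hσ₂, hξ₀⟩ := (isCompact_closedBall (0 : Fin n → ℝ) R).tendsto_subseq
    (x := fun k => ξ (σ₁ k)) (fun k => by simpa using hξ (σ₁ k))
  set σ := fun k => σ₁ (σ₂ k)
  have hσ : StrictMono σ := hσ₁.comp hσ₂
  have hφσ : WeakStarTendsto (fun k => φ (σ k)) φ₀ := fun g hg =>
    (hφ₀ g hg).comp hσ₂.tendsto_atTop
  obtain ⟨x₀, hx₀⟩ := hfc t₀ ht₀ ξ₀ φ₀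
  -- The horizon is enlarged to lie strictly beyond `t₀ + r`, as the convergence of the integrals
  -- requires.
  set T' := max T (t₀ + r) + 1
  have hTT' : T ≤ T' := (le_max_left _ _).trans (by linarith)
  have hrT' : t₀ + r < T' := (le_max_right T (t₀ + r)).trans_lt (by linarith)
  have ht₀T' : t₀ < T' := hT.trans_le hTT'
  have hx₀c : ContinuousOn x₀ (Icc t₀ T') := hx₀.1.continuousOn ht₀T'.le ht₀T'.le
  obtain ⟨C, hC⟩ := isCompact_Icc.exists_bound_of_continuousOn hx₀c
  set R' := max (C + 1) (max R ‖φ₀‖)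
  have hCR' : C + 1 ≤ R' := le_max_left _ _
  have hRR' : R ≤ R' := (le_max_left _ _).trans (le_max_right _ _)
  have hφ₀R' : ‖φ₀‖ ≤ R' := (le_max_right _ _).trans (le_max_right _ _)
  have hR' : 0 < R' := hR.trans_le hRR'
  obtain ⟨L, hL, hLf⟩ := hf.lipschitz R' hR' T' (ht₀.trans_lt ht₀T')
  obtain ⟨Z, hZ, hLip⟩ := hLf f rfl
  set e := Real.exp (L * (T' - t₀))
  have he : 0 < e := Real.exp_pos _
  -- The barrier starts at `δ' = 1 / e`, so that it reaches exactly 1 at `T'`. Integrals and initial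
  -- values contribute a quarter of `1 / e` each, giving `δ = 1 / e / 2 < δ'`.
  obtain ⟨N₁, hN₁⟩ := hf.exists_forall_norm_integral_along_sub_lt hτ ht₀ hrT' hR' hx₀c
    (fun t ht => by linarith [hC t ht]) (fun k => (hφ (σ k)).trans hRR') hφ₀R' hφσ
    (ε := 1 / e / 4) (by positivity)
  obtain ⟨N₂, hN₂⟩ := Metric.tendsto_atTop.1 hξ₀ (1 / e / 4) (by positivity)
  -- For the contradiction: `‖x (σ k) (t (σ k))‖ ≤ C + 1 ≤ R' ≤ N₃ ≤ σ k`.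
  obtain ⟨N₃, hN₃⟩ := exists_nat_ge R'
  set k := max N₁ (max N₂ N₃)
  have hk₁ : N₁ ≤ k := le_max_left _ _
  have hk₂ : N₂ ≤ k := (le_max_left _ _).trans (le_max_right _ _)
  have hk₃ : N₃ ≤ k := (le_max_right _ _).trans (le_max_right _ _)
  have hpos : 0 < 1 / e := by positivity
  have hclose := (hx (σ k)).1.norm_sub_lt hτ hf.toUniformLipschitz ht₀ ht₀T' hL hZ hLip hx₀.1
    (by rw [hJ]; exact Icc_subset_Ici_self) Icc_subset_Ici_self ((hφ (σ k)).trans hRR')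
    (fun t ht => by linarith [hC t ht]) (δ := 1 / e / 2) (δ' := 1 / e) (by positivity)
    (by linarith) (by rw [one_div, inv_mul_cancel₀ he.ne'])
    (fun s hs => by
      have h1 := hN₁ k hk₁ s hs
      have h2 := hN₂ k hk₂
      rw [dist_eq_norm] at h2
      have h3 : ‖ξ (σ k) - ξ₀‖ < 1 / e / 4 := h2
      linarith) (t (σ k)) ⟨(ht _).1, (ht _).2.trans hTT'⟩
  have hle1 : 1 / e * Real.exp (L * (t (σ k) - t₀)) ≤ 1 := by
    rw [one_div, ← div_eq_inv_mul, div_le_one he]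
    refine Real.exp_le_exp.2 (mul_le_mul_of_nonneg_left ?_ hL)
    linarith [(ht (σ k)).2]
  have h1 := hC (t (σ k)) ⟨(ht _).1, (ht _).2.trans hTT'⟩
  have h2 := norm_le_norm_add_norm_sub (x₀ (t (σ k))) (x (σ k) (t (σ k)))
  rw [norm_sub_rev (x₀ (t (σ k)))] at h2
  have h3 := hlarge (σ k)
  have h4 : (N₃ : ℝ) ≤ σ k := by exact_mod_cast hk₃.trans (hσ.id_le k)
  linarith

end DelaySystem

theorem corollary1 (n ℓ : ℕ) (r : ℝ) (τ : Fin (ℓ + 1) → ℝ) (hτ : StrictMono τ) (hτ0 : τ 0 = 0)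
    (hτr : τ (Fin.last ℓ) = r) (f : DelaySystem.RHS n ℓ r)
    (hf : DelaySystem.WeakStarAssumption τ {f}) :
    DelaySystem.ForwardComplete τ f ↔ DelaySystem.BoundedReachabilitySets τ f := by
  have hmem : ∀ i, τ i ∈ Icc 0 r := fun i =>
    ⟨hτ0 ▸ hτ.monotone (Fin.zero_le i), hτr ▸ hτ.monotone (Fin.le_last i)⟩
  exact ⟨fun h => h.boundedReachabilitySets hmem hf, fun h => h.1⟩
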